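/- Let $N$ be a natural number, and let $A,B\in\mathbb{C}^{N\times N}$ be (Hermitian) positive semidefinite matrices with eigenvalues, counted with multiplicity and arranged in descending order, $\lambda_1(A)\ge\dots\ge\lambda_N(A)$ and $\lambda_1(B)\ge\dots\ge\lambda_N(B)$. Let $D=\operatorname{diag}(d_1,\dots,d_N)$ be a real diagonal matrix with $d_1\ge\dots\ge d_N\ge 0$. Then $\det(D^HAD+B)$ is real and $$\det(D^HAD+B)\le\prod_{k=1}^N\bigl(d_k^2\,\lambda_k(A)+\lambda_{N+1-k}(B)\bigr).$$ Moreover, if $A$ and $B$ are diagonal, the diagonal entries of $A$ are in descending order and the diagonal entries of $B$ are in ascending order, then $A=\operatorname{diag}(\lambda_1(A),\dots,\lambda_N(A))$, $B=\operatorname{diag}(\lambda_N(B),\dots,\lambda_1(B))$, and equality holds in the above inequality. -/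

import Mathlib

open scoped ComplexOrder

/-- `eigDesc hA k` is the `k`-th largest eigenvalue (counted with multiplicity, indices starting
at `0`) of the Hermitian matrix `A`.  Mathlib's `eigenvalues₀` is the list of eigenvalues in
descending order, indexed by `Fin (Fintype.card (Fin N))`; only the index type is changed. -/
noncomputable def eigDesc {N : ℕ} {A : Matrix (Fin N) (Fin N) ℂ} (hA : A.IsHermitian)
    (k : Fin N) : ℝ :=
  hA.eigenvalues₀ (Fin.cast (Fintype.card_fin N).symm k)

/-! Suppose first that `B` is positive definite with ascending eigenvalues `b k`, and choose `S`
with `Sᴴ * B * S = 1`. Then the determinant is `∏ b k` times `det (1 + M)`, where `M = (D * S)ᴴ * A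
* (D * S)`. Compressing `M` to its top `m` eigenvectors and applying Cauchy–Binet to `A`, `Dᴴ * D`
and `Sᴴ * S` in turn bounds the product of the `m` largest eigenvalues of `M` by the product of the
first `m` numbers `d k ^ 2 * a k / b k`. Such weak log-majorization survives `t ↦ 1 + t`, because
`log (1 + exp t)` is convex and increasing; multiplying back by `∏ b k` gives the bound. Singular
`B` follows by continuity. -/

/-! ### Cauchy–Binet and determinants of compressions -/

open Matrix in
/-- The Cauchy–Binet formula, as a sum over all index functions. -/
theorem factorial_mul_det_mul {R : Type*} [CommRing R] {m n : ℕ}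
    (X : Matrix (Fin m) (Fin n) R) (Y : Matrix (Fin n) (Fin m) R) :
    (m.factorial : R) * (X * Y).det =
      ∑ f : Fin m → Fin n, (X.submatrix id f).det * (Y.submatrix f id).det := by
  have h1 : (X * Y).det = ∑ f : Fin m → Fin n, (∏ i, X i (f i)) * (Y.submatrix f id).det := by
    have h := (detRowAlternating (n := Fin m) (R := R)).toMultilinearMap.map_sum
      (fun i j => X i j • Y j)
    have e : (X * Y) = fun i => ∑ j, X i j • Y j := by
      ext i k
      simp [mul_apply, Finset.sum_apply]
    rw [e]
    refine h.trans (Finset.sum_congr rfl fun f _ => ?_)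
    have h2 := (detRowAlternating (n := Fin m) (R := R)).toMultilinearMap.map_smul_univ
      (fun i => X i (f i)) (fun i => Y (f i))
    exact h2
  -- Replacing `f` by `f ∘ σ` costs a sign from `Y`; summing over all `σ` assembles the minor of `X`
  -- and produces the factor `m!`.
  have h2 : ∀ σ : Equiv.Perm (Fin m), (X * Y).det = ∑ f : Fin m → Fin n,
      ((Equiv.Perm.sign σ : ℤ) : R) * (∏ i, X i (f (σ i))) * (Y.submatrix f id).det := by
    intro σ
    rw [h1, ← Equiv.sum_comp (Equiv.arrowCongr σ⁻¹ (Equiv.refl (Fin n)))]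
    refine Finset.sum_congr rfl fun f _ => ?_
    have e : Y.submatrix ((Equiv.arrowCongr σ⁻¹ (Equiv.refl (Fin n))) f) id =
        (Y.submatrix f id).submatrix σ id := by
      ext i j; rfl
    rw [e, det_permute]
    have e2 : ∀ i, (Equiv.arrowCongr σ⁻¹ (Equiv.refl (Fin n))) f i = f (σ i) := fun i => rfl
    simp only [e2]
    ring
  have h3 : (m.factorial : R) * (X * Y).det = ∑ _σ : Equiv.Perm (Fin m), (X * Y).det := by
    rw [Finset.sum_const, Finset.card_univ, Fintype.card_perm, Fintype.card_fin, nsmul_eq_mul]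
  rw [h3, Finset.sum_congr rfl fun σ _ => h2 σ, Finset.sum_comm]
  refine Finset.sum_congr rfl fun f _ => ?_
  rw [← Finset.sum_mul, ← det_transpose (X.submatrix id f), det_apply' (X.submatrix id f)ᵀ]
  rfl

theorem prod_comp_le_prod_castLE {m n : ℕ} (h : m ≤ n) {p : Fin n → ℝ} (hp : Antitone p)
    (hp0 : ∀ k, 0 ≤ p k) {f : Fin m → Fin n} (hf : Function.Injective f) :
    ∏ i, p (f i) ≤ ∏ i : Fin m, p (Fin.castLE h i) := by
  classical
  have hc : (Finset.univ.image f).card = m := by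
    rw [Finset.card_image_of_injective _ hf, Finset.card_univ, Fintype.card_fin]
  set g := (Finset.univ.image f).orderEmbOfFin hc with hg
  have h1 : ∏ i, p (f i) = ∏ i, p (g i) := by
    rw [← Finset.prod_image (s := Finset.univ) (g := f) (f := p) hf.injOn,
      ← Finset.prod_image (s := Finset.univ) (g := g) (f := p) g.injective.injOn,
      Finset.image_orderEmbOfFin_univ]
  rw [h1]
  refine Finset.prod_le_prod (fun _ _ => hp0 _) fun i _ => hp ?_
  -- A strictly increasing sequence of naturals has `k`-th term at least `k`.
  have key : ∀ k (hk : k < m), k ≤ (g ⟨k, hk⟩ : ℕ) := by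
    intro k
    induction k with
    | zero => intro _; exact Nat.zero_le _
    | succ k ih =>
      intro hk
      have h2 : g ⟨k, by omega⟩ < g ⟨k + 1, hk⟩ := g.strictMono (by simp [Fin.lt_def])
      have := ih (by omega)
      have h3 : (g ⟨k, by omega⟩ : ℕ) < g ⟨k + 1, hk⟩ := h2
      omega
  exact key i i.2

-- By Cauchy–Binet both determinants are sums of squared moduli of minors of `Y`, the left one
-- weighted by products of `m` distinct values of `p`. Non-injective `f` give a repeated row, hence
-- a zero minor.
open Matrix in
theorem det_conjTranspose_mul_diagonal_mul_le {m n : ℕ} (h : m ≤ n) {p : Fin n → ℝ}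
    (hp : Antitone p) (hp0 : ∀ k, 0 ≤ p k) (Y : Matrix (Fin n) (Fin m) ℂ) :
    (Yᴴ * diagonal (fun k => (p k : ℂ)) * Y).det ≤
      ((∏ i : Fin m, p (Fin.castLE h i) : ℝ) : ℂ) * (Yᴴ * Y).det := by
  have e1 : (m.factorial : ℂ) * (Yᴴ * diagonal (fun k => (p k : ℂ)) * Y).det =
      ((∑ f : Fin m → Fin n, (∏ i, p (f i)) * Complex.normSq (Y.submatrix f id).det : ℝ) : ℂ) := by
    rw [factorial_mul_det_mul]
    push_cast
    refine Finset.sum_congr rfl fun f _ => ?_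
    have : (Yᴴ * diagonal (fun k => (p k : ℂ))).submatrix id f =
        (Y.submatrix f id)ᴴ * diagonal (fun i => (p (f i) : ℂ)) := by
      ext i j; simp
    rw [this, det_mul, det_diagonal, det_conjTranspose, Complex.normSq_eq_conj_mul_self]
    simp only [← starRingEnd_apply]
    ring
  have e2 : (m.factorial : ℂ) * (Yᴴ * Y).det =
      ((∑ f : Fin m → Fin n, Complex.normSq (Y.submatrix f id).det : ℝ) : ℂ) := by
    rw [factorial_mul_det_mul]
    push_cast
    refine Finset.sum_congr rfl fun f _ => ?_
    have : Yᴴ.submatrix id f = (Y.submatrix f id)ᴴ := rfl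
    rw [this, det_conjTranspose, Complex.normSq_eq_conj_mul_self]
    simp only [← starRingEnd_apply]
  have hpos : (0 : ℂ) < (m.factorial : ℂ) := by
    have := Nat.factorial_pos m
    exact_mod_cast this
  refine le_of_mul_le_mul_left ?_ hpos
  rw [mul_left_comm, e1, e2, ← Complex.ofReal_mul, Complex.real_le_real, Finset.mul_sum]
  refine Finset.sum_le_sum fun f _ => ?_
  by_cases hf : Function.Injective f
  · exact mul_le_mul_of_nonneg_right (prod_comp_le_prod_castLE h hp hp0 hf)
      (Complex.normSq_nonneg _)
  · obtain ⟨i, j, hij, hne⟩ : ∃ i j, f i = f j ∧ i ≠ j := by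
      simpa [Function.Injective] using hf
    have : (Y.submatrix f id).det = 0 := det_zero_of_row_eq hne (by ext k; simp [hij])
    simp [this]

open Matrix in
theorem det_conjTranspose_mul_mul_le_of_spectral {m n : ℕ} (h : m ≤ n) {p : Fin n → ℝ}
    (hp : Antitone p) (hp0 : ∀ k, 0 ≤ p k) {U P : Matrix (Fin n) (Fin n) ℂ} (hU : U * Uᴴ = 1)
    (hP : P = U * diagonal (fun k => (p k : ℂ)) * Uᴴ) (Y : Matrix (Fin n) (Fin m) ℂ) :
    (Yᴴ * P * Y).det ≤ ((∏ i : Fin m, p (Fin.castLE h i) : ℝ) : ℂ) * (Yᴴ * Y).det := by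
  have := det_conjTranspose_mul_diagonal_mul_le h hp hp0 (Uᴴ * Y)
  have e : (Uᴴ * Y)ᴴ * (Uᴴ * Y) = Yᴴ * Y := by
    rw [conjTranspose_mul, conjTranspose_conjTranspose, Matrix.mul_assoc, ← Matrix.mul_assoc U,
      hU, Matrix.one_mul]
  rw [e] at this
  convert this using 2
  rw [hP, conjTranspose_mul, conjTranspose_conjTranspose]
  simp only [Matrix.mul_assoc]

/-! ### Scalar weak log-majorization -/

theorem sum_mul_nonneg_of_antitone {g L : ℕ → ℝ} (hg : Antitone g) (hg0 : ∀ k, 0 ≤ g k) {n : ℕ}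
    (hL : ∀ m ≤ n, 0 ≤ ∑ k ∈ Finset.range m, L k) :
    0 ≤ ∑ k ∈ Finset.range n, g k * L k := by
  -- Abel summation, in a form strong enough for induction.
  have key : g n * ∑ k ∈ Finset.range n, L k ≤ ∑ k ∈ Finset.range n, g k * L k := by
    induction n with
    | zero => simp
    | succ n ih =>
      have h1 := ih fun m hm => hL m (by omega)
      have h2 := mul_le_mul_of_nonneg_right (hg n.le_succ) (hL (n + 1) le_rfl)
      refine h2.trans ?_
      rw [Finset.sum_range_succ, Finset.sum_range_succ, mul_add]
      linarith
  exact (mul_nonneg (hg0 n) (hL n le_rfl)).trans key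

/-- Tangent-line bound for the convex function `log (1 + exp t)` at `t = log x`, obtained from
concavity of `log` at the points `1` and `y / x`. -/
theorem mul_log_sub_log_le {x y : ℝ} (hx : 0 < x) (hy : 0 < y) :
    x / (1 + x) * (Real.log y - Real.log x) ≤ Real.log (1 + y) - Real.log (1 + x) := by
  have hx1 : 0 < 1 + x := by linarith
  have h := (strictConcaveOn_log_Ioi.concaveOn).2 (Set.mem_Ioi.2 one_pos)
    (Set.mem_Ioi.2 (div_pos hy hx)) (show 0 ≤ 1 / (1 + x) by positivity)
    (show 0 ≤ x / (1 + x) by positivity) (by field_simp)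
  simp only [smul_eq_mul, Real.log_one, mul_zero, zero_add] at h
  rw [← Real.log_div hy.ne' hx.ne', ← Real.log_div (by linarith) hx1.ne']
  have e : 1 / (1 + x) * 1 + x / (1 + x) * (y / x) = (1 + y) / (1 + x) := by
    field_simp
  rwa [e] at h

/-- Weak log-majorization is preserved by `t ↦ 1 + t`. -/
theorem prod_one_add_le_of_prod_le {x y : ℕ → ℝ} (hx : Antitone x) (hx0 : ∀ k, 0 ≤ x k)
    (hy0 : ∀ k, 0 ≤ y k) {n : ℕ}
    (h : ∀ m ≤ n, ∏ k ∈ Finset.range m, x k ≤ ∏ k ∈ Finset.range m, y k) :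
    ∏ k ∈ Finset.range n, (1 + x k) ≤ ∏ k ∈ Finset.range n, (1 + y k) := by
  induction n with
  | zero => simp
  | succ n ih =>
    -- If the smallest `x` vanishes, its factor is `1` and can be dropped; otherwise all `x k` and
    -- `y k` are positive and logarithms are available.
    rcases (hx0 n).eq_or_lt with h0 | h0
    · rw [Finset.prod_range_succ, Finset.prod_range_succ, ← h0]
      exact mul_le_mul (ih fun m hm => h m (by omega)) (by linarith [hy0 n]) (by norm_num)
        (Finset.prod_nonneg fun k _ => by linarith [hy0 k])
    · have hxp : ∀ k ∈ Finset.range (n + 1), 0 < x k := fun k hk =>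
        h0.trans_le (hx (by simpa [Nat.lt_succ_iff] using hk))
      have hyp : ∀ k ∈ Finset.range (n + 1), 0 < y k := by
        have h1 := (Finset.prod_pos hxp).trans_le (h _ le_rfl)
        intro k hk
        exact (hy0 k).lt_of_ne' fun h2 => h1.ne' (Finset.prod_eq_zero hk h2)
      have hL : ∀ m ≤ n + 1, 0 ≤ ∑ k ∈ Finset.range m, (Real.log (y k) - Real.log (x k)) := by
        intro m hm
        have hsub : ∀ k ∈ Finset.range m, k ∈ Finset.range (n + 1) := fun k hk => by
          simp only [Finset.mem_range] at hk ⊢; omega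
        rw [Finset.sum_sub_distrib, ← Real.log_prod fun k hk => (hyp k (hsub k hk)).ne',
          ← Real.log_prod fun k hk => (hxp k (hsub k hk)).ne', sub_nonneg]
        exact Real.log_le_log (Finset.prod_pos fun k hk => hxp k (hsub k hk)) (h m hm)
      have hg : Antitone fun k => x k / (1 + x k) := by
        intro i j hij
        have := hx hij
        rw [div_le_div_iff₀ (by linarith [hx0 j]) (by linarith [hx0 i])]
        linarith
      have h3 := sum_mul_nonneg_of_antitone hg
        (fun k => div_nonneg (hx0 k) (by linarith [hx0 k])) hL
      have h4 := h3.trans (Finset.sum_le_sum fun k hk => mul_log_sub_log_le (hxp k hk) (hyp k hk))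
      rw [Finset.sum_sub_distrib, ← Real.log_prod fun k _ => (by linarith [hy0 k]),
        ← Real.log_prod fun k _ => (by linarith [hx0 k]), sub_nonneg] at h4
      exact (Real.log_le_log_iff (Finset.prod_pos fun k _ => by linarith [hx0 k])
        (Finset.prod_pos fun k _ => by linarith [hy0 k])).1 h4

theorem prod_one_add_le_of_prod_castLE_le {n : ℕ} {x y : Fin n → ℝ} (hx : Antitone x)
    (hx0 : ∀ k, 0 ≤ x k) (hy0 : ∀ k, 0 ≤ y k)
    (h : ∀ m (hm : m ≤ n), ∏ k : Fin m, x (Fin.castLE hm k) ≤ ∏ k : Fin m, y (Fin.castLE hm k)) :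
    ∏ k, (1 + x k) ≤ ∏ k, (1 + y k) := by
  have h1 := prod_one_add_le_of_prod_le (n := n)
    (x := fun k => if hk : k < n then x ⟨k, hk⟩ else 0)
    (y := fun k => if hk : k < n then y ⟨k, hk⟩ else 0) ?_ ?_ ?_ ?_
  · rw [Finset.prod_range, Finset.prod_range] at h1
    simpa using h1
  · intro i j hij
    by_cases hj : j < n
    · have hi : i < n := by omega
      simpa [hi, hj] using hx (show (⟨i, hi⟩ : Fin n) ≤ ⟨j, hj⟩ from hij)
    · simp only [hj, dite_false]
      split_ifs
      exacts [hx0 _, le_rfl]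
  · intro k; split_ifs; exacts [hx0 _, le_rfl]
  · intro k; split_ifs; exacts [hy0 _, le_rfl]
  · intro m hm
    rw [Finset.prod_range, Finset.prod_range]
    have h2 : ∀ k : Fin m, (k : ℕ) < n := fun k => by omega
    simp only [h2, dite_true]
    exact h m hm

/-! ### Ordered eigenvalues -/

theorem antitone_eigDesc {N : ℕ} {A : Matrix (Fin N) (Fin N) ℂ} (hA : A.IsHermitian) :
    Antitone (eigDesc hA) := fun _ _ h => hA.eigenvalues₀_antitone h

theorem eigDesc_nonneg {N : ℕ} {A : Matrix (Fin N) (Fin N) ℂ} (hA : A.PosSemidef) (k : Fin N) :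
    0 ≤ eigDesc hA.isHermitian k := by
  have h := hA.eigenvalues_nonneg ((Fintype.equivOfCardEq (Fintype.card_fin _))
    (Fin.cast (Fintype.card_fin N).symm k))
  simpa [Matrix.IsHermitian.eigenvalues, eigDesc] using h

-- The permutation `σ` allows `A` to be diagonalized in descending order and `B` in ascending order.
open Matrix in
theorem exists_unitary_diagonalization {N : ℕ} {A : Matrix (Fin N) (Fin N) ℂ}
    (hA : A.IsHermitian) (σ : Equiv.Perm (Fin N)) :
    ∃ U : Matrix (Fin N) (Fin N) ℂ, U * Uᴴ = 1 ∧ Uᴴ * U = 1 ∧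
      A = U * diagonal (fun k => (eigDesc hA (σ k) : ℂ)) * Uᴴ := by
  let e : Fin N ≃ Fin N := (σ.trans (finCongr (Fintype.card_fin N).symm)).trans
    (Fintype.equivOfCardEq (Fintype.card_fin _))
  let V : Matrix (Fin N) (Fin N) ℂ := hA.eigenvectorUnitary
  have hV : V * Vᴴ = 1 := Unitary.coe_mul_star_self hA.eigenvectorUnitary
  have h1 : (V.submatrix id e) * (V.submatrix id e)ᴴ = 1 := by
    rw [conjTranspose_submatrix, submatrix_mul_equiv, hV]
    simp
  refine ⟨V.submatrix id e, h1, mul_eq_one_comm.1 h1, ?_⟩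
  have e1 : diagonal (fun k => (eigDesc hA (σ k) : ℂ)) =
      (diagonal (fun k => (hA.eigenvalues k : ℂ))).submatrix e e := by
    rw [submatrix_diagonal_equiv]
    congr 1
    ext k
    simp [IsHermitian.eigenvalues, eigDesc, e]
  rw [e1, conjTranspose_submatrix, submatrix_mul_equiv, submatrix_mul_equiv]
  exact hA.spectral_theorem

open Matrix in
theorem eigDesc_eq_of_roots_charpoly {N : ℕ} {A : Matrix (Fin N) (Fin N) ℂ} (hA : A.IsHermitian)
    {a : Fin N → ℝ} (ha : Antitone a)
    (h : A.charpoly.roots = Multiset.map (fun k => (a k : ℂ)) Finset.univ.val) :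
    eigDesc hA = a := by
  have h0 : A.charpoly.roots = Multiset.map (fun k => (eigDesc hA k : ℂ)) Finset.univ.val := by
    rw [hA.roots_charpoly_eq_eigenvalues₀]
    have h2 : (Finset.univ : Finset (Fin (Fintype.card (Fin N)))).val =
        Multiset.map (Fin.cast (Fintype.card_fin N).symm) Finset.univ.val :=
      (Multiset.map_univ_val_equiv (finCongr (Fintype.card_fin N).symm)).symm
    rw [h2, Multiset.map_map]
    rfl
  have h1 := congrArg (Multiset.map Complex.re) (h0.symm.trans h)
  rw [Multiset.map_map, Multiset.map_map] at h1
  simp only [Function.comp_def, Complex.ofReal_re, Fin.univ_val_map, Multiset.coe_eq_coe] at h1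
  exact List.ofFn_injective
    (h1.eq_of_sortedGE (antitone_eigDesc hA).sortedGE_ofFn ha.sortedGE_ofFn)

/-! ### The determinant inequality -/

open Matrix in
theorem det_conj_add_le_of_pos {N : ℕ} {a d b : Fin N → ℝ} (ha : Antitone a) (ha0 : ∀ k, 0 ≤ a k)
    (hd : Antitone d) (hd0 : ∀ k, 0 ≤ d k) (hb : Monotone b) (hb0 : ∀ k, 0 < b k)
    {A U W D : Matrix (Fin N) (Fin N) ℂ} (hU : U * Uᴴ = 1) (hW : W * Wᴴ = 1)
    (hA : A = U * diagonal (fun k => (a k : ℂ)) * Uᴴ)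
    (hD : D = diagonal (fun k => (d k : ℂ))) :
    (Dᴴ * A * D + W * diagonal (fun k => (b k : ℂ)) * Wᴴ).det ≤
      ((∏ k, (d k ^ 2 * a k + b k) : ℝ) : ℂ) := by
  have hW' : Wᴴ * W = 1 := mul_eq_one_comm.1 hW
  set B := W * diagonal (fun k => (b k : ℂ)) * Wᴴ with hB
  let s : Fin N → ℝ := fun k => (√(b k))⁻¹
  have hs : ∀ k, s k * s k = (b k)⁻¹ := fun k => by
    rw [← mul_inv, Real.mul_self_sqrt (hb0 k).le]
  let S : Matrix (Fin N) (Fin N) ℂ := W * diagonal (fun k => (s k : ℂ))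
  have hdiag : ∀ f : Fin N → ℝ,
      (diagonal (fun k => (f k : ℂ)))ᴴ = diagonal (fun k => (f k : ℂ)) := fun f => by
    rw [diagonal_conjTranspose]; congr 1; ext k; simp
  have hSS : Sᴴ * S = diagonal (fun k => (((b k)⁻¹ : ℝ) : ℂ)) := by
    simp only [S, conjTranspose_mul, hdiag]
    rw [Matrix.mul_assoc, ← Matrix.mul_assoc Wᴴ, hW', Matrix.one_mul, diagonal_mul_diagonal]
    congr 1; ext k; rw [← hs]; push_cast; rfl
  have hSBS : Sᴴ * B * S = 1 := by
    simp only [S, hB, conjTranspose_mul, hdiag]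
    have : diagonal (fun k => (s k : ℂ)) * Wᴴ * (W * diagonal (fun k => (b k : ℂ)) * Wᴴ) *
        (W * diagonal (fun k => (s k : ℂ))) = diagonal (fun k => (s k : ℂ)) * (Wᴴ * W) *
          diagonal (fun k => (b k : ℂ)) * (Wᴴ * W) * diagonal (fun k => (s k : ℂ)) := by
      simp only [Matrix.mul_assoc]
    rw [this, hW', Matrix.mul_one, Matrix.mul_one, diagonal_mul_diagonal, diagonal_mul_diagonal,
      ← diagonal_one]
    congr 1; ext k
    have h1 : s k * b k * s k = 1 := by
      rw [mul_right_comm, hs, inv_mul_cancel₀ (hb0 k).ne']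
    exact_mod_cast h1
  have hA' : A.PosSemidef := by
    rw [hA]
    refine PosSemidef.mul_mul_conjTranspose_same ?_ U
    exact PosSemidef.diagonal fun k => by simpa using ha0 k
  let M := (D * S)ᴴ * A * (D * S)
  have hM : M.PosSemidef := hA'.conjTranspose_mul_mul_same (D * S)
  obtain ⟨V, hV, hV', hVM⟩ := exists_unitary_diagonalization hM.isHermitian (Equiv.refl _)
  simp only [Equiv.refl_apply] at hVM
  set μ := eigDesc hM.isHermitian with hμ
  have hDD : Dᴴ * D = diagonal (fun k => ((d k ^ 2 : ℝ) : ℂ)) := by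
    rw [hD, hdiag, diagonal_mul_diagonal]
    congr 1; ext k; push_cast; ring
  have hd2 : Antitone fun k => d k ^ 2 := fun i j hij => pow_le_pow_left₀ (hd0 j) (hd hij) 2
  have hbi : Antitone fun k => (b k)⁻¹ := fun i j hij => inv_anti₀ (hb0 i) (hb hij)
  -- The columns of `Y` are the top `m` eigenvectors of `M`; `i1`, `i2`, `i3` peel off `A`, `Dᴴ * D`
  -- and `Sᴴ * S`.
  have hmaj : ∀ m (hm : m ≤ N), ∏ k : Fin m, μ (Fin.castLE hm k) ≤
      ∏ k : Fin m, (fun k => d k ^ 2 * a k * (b k)⁻¹) (Fin.castLE hm k) := by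
    intro m hm
    let Y : Matrix (Fin N) (Fin m) ℂ := V.submatrix id (Fin.castLE hm)
    have hinj : Function.Injective (Fin.castLE hm) := Fin.castLE_injective hm
    have hYY : Yᴴ * Y = 1 := by
      have : Yᴴ * Y = (Vᴴ * V).submatrix (Fin.castLE hm) (Fin.castLE hm) := by
        ext i j; simp [Y, mul_apply]
      rw [this, hV', submatrix_one _ hinj]
    have hYM : Yᴴ * M * Y = diagonal fun k : Fin m => (μ (Fin.castLE hm k) : ℂ) := by
      have e : Yᴴ * M * Y = (Vᴴ * M * V).submatrix (Fin.castLE hm) (Fin.castLE hm) := by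
        ext i j; simp [Y, mul_apply]
      have e2 : Vᴴ * M * V = diagonal fun k => (μ k : ℂ) := by
        rw [hVM]
        have : Vᴴ * (V * diagonal (fun k => (μ k : ℂ)) * Vᴴ) * V =
          (Vᴴ * V) * diagonal (fun k => (μ k : ℂ)) * (Vᴴ * V) := by simp only [Matrix.mul_assoc]
        rw [this, hV', Matrix.mul_one, Matrix.one_mul]
      rw [e, e2, submatrix_diagonal _ _ hinj]
      rfl
    have i1 := det_conjTranspose_mul_mul_le_of_spectral hm ha ha0 hU hA (D * S * Y)
    have i2 := det_conjTranspose_mul_diagonal_mul_le hm hd2 (fun k => sq_nonneg _) (S * Y)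
    have i3 := det_conjTranspose_mul_diagonal_mul_le hm hbi (fun k => (inv_pos.2 (hb0 k)).le) Y
    rw [← hSS] at i3
    rw [← hDD] at i2
    have e1 : (D * S * Y)ᴴ * A * (D * S * Y) = Yᴴ * M * Y := by
      simp only [M, conjTranspose_mul, Matrix.mul_assoc]
    have e2 : (D * S * Y)ᴴ * (D * S * Y) = (S * Y)ᴴ * (Dᴴ * D) * (S * Y) := by
      simp only [conjTranspose_mul, Matrix.mul_assoc]
    have e3 : (S * Y)ᴴ * (S * Y) = Yᴴ * (Sᴴ * S) * Y := by
      simp only [conjTranspose_mul, Matrix.mul_assoc]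
    rw [e1, e2, hYM, det_diagonal] at i1
    rw [e3] at i2
    rw [hYY, det_one, mul_one] at i3
    have pa : (0 : ℂ) ≤ ((∏ i : Fin m, a (Fin.castLE hm i) : ℝ) : ℂ) := by
      rw [Complex.zero_le_real]; exact Finset.prod_nonneg fun _ _ => ha0 _
    have pd : (0 : ℂ) ≤ ((∏ i : Fin m, d (Fin.castLE hm i) ^ 2 : ℝ) : ℂ) := by
      rw [Complex.zero_le_real]; exact Finset.prod_nonneg fun _ _ => sq_nonneg _
    have i4 := i1.trans (mul_le_mul_of_nonneg_left
      (i2.trans (mul_le_mul_of_nonneg_left i3 pd)) pa)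
    rw [← Complex.ofReal_prod, ← Complex.ofReal_mul, ← Complex.ofReal_mul,
      Complex.real_le_real] at i4
    refine i4.trans_eq ?_
    simp only [Finset.prod_mul_distrib]
    ring
  have hfin := prod_one_add_le_of_prod_castLE_le (antitone_eigDesc hM.isHermitian)
    (eigDesc_nonneg hM)
    (fun k => mul_nonneg (mul_nonneg (sq_nonneg _) (ha0 k)) (inv_pos.2 (hb0 k)).le) hmaj
  have hdet1 : (1 + M).det = ((∏ k, (1 + μ k) : ℝ) : ℂ) := by
    have : 1 + M = V * diagonal (fun k => ((1 + μ k : ℝ) : ℂ)) * Vᴴ := by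
      have e : diagonal (fun k => ((1 + μ k : ℝ) : ℂ)) = 1 + diagonal (fun k => (μ k : ℂ)) := by
        rw [← diagonal_one, diagonal_add]; congr 1; ext k; push_cast; rfl
      rw [e, Matrix.mul_add, Matrix.add_mul, Matrix.mul_one, hV, ← hVM]
    rw [this, det_mul_right_comm, hV, Matrix.one_mul, det_diagonal]
    push_cast; rfl
  have hdet2 : (1 + M).det = (Dᴴ * A * D + B).det * ((∏ k, (b k)⁻¹ : ℝ) : ℂ) := by
    have e : 1 + M = Sᴴ * (Dᴴ * A * D + B) * S := by
      rw [Matrix.mul_add, Matrix.add_mul, hSBS, add_comm]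
      simp only [M, conjTranspose_mul, Matrix.mul_assoc]
    have e2 : (Sᴴ * S).det = ((∏ k, (b k)⁻¹ : ℝ) : ℂ) := by
      rw [hSS, det_diagonal]; push_cast; rfl
    rw [e, ← e2, det_mul _ S, det_mul Sᴴ, det_mul Sᴴ]
    ring
  have hbp : (0 : ℝ) < ∏ k, b k := Finset.prod_pos fun k _ => hb0 k
  have hdet3 : (Dᴴ * A * D + B).det = ((∏ k, b k * (1 + μ k) : ℝ) : ℂ) := by
    have h1 : ((∏ k, b k : ℝ) : ℂ) * ((∏ k, (b k)⁻¹ : ℝ) : ℂ) = 1 := by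
      rw [← Complex.ofReal_mul, ← Finset.prod_mul_distrib,
        Finset.prod_congr rfl fun k _ => mul_inv_cancel₀ (hb0 k).ne']
      simp
    rw [Finset.prod_mul_distrib, Complex.ofReal_mul, ← hdet1, hdet2, mul_left_comm, h1, mul_one]
  rw [hdet3, Complex.real_le_real, Finset.prod_mul_distrib]
  refine (mul_le_mul_of_nonneg_left hfin hbp.le).trans_eq ?_
  rw [← Finset.prod_mul_distrib]
  refine Finset.prod_congr rfl fun k _ => ?_
  have := (hb0 k).ne'
  field_simp
  ring

open Matrix Filter Topology in
theorem det_conj_add_le {N : ℕ} {a d b : Fin N → ℝ} (ha : Antitone a) (ha0 : ∀ k, 0 ≤ a k)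
    (hd : Antitone d) (hd0 : ∀ k, 0 ≤ d k) (hb : Monotone b) (hb0 : ∀ k, 0 ≤ b k)
    {A U W D : Matrix (Fin N) (Fin N) ℂ} (hU : U * Uᴴ = 1) (hW : W * Wᴴ = 1)
    (hA : A = U * diagonal (fun k => (a k : ℂ)) * Uᴴ)
    (hD : D = diagonal (fun k => (d k : ℂ))) :
    (Dᴴ * A * D + W * diagonal (fun k => (b k : ℂ)) * Wᴴ).det ≤
      ((∏ k, (d k ^ 2 * a k + b k) : ℝ) : ℂ) := by
  have hl : Continuous fun ε : ℝ =>
      (Dᴴ * A * D + W * diagonal (fun k => ((b k + ε : ℝ) : ℂ)) * Wᴴ).det := by fun_prop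
  have hr : Continuous fun ε : ℝ => ((∏ k, (d k ^ 2 * a k + (b k + ε)) : ℝ) : ℂ) := by fun_prop
  have tl := (hl.tendsto 0).mono_left (nhdsWithin_le_nhds (s := Set.Ioi 0))
  have tr := (hr.tendsto 0).mono_left (nhdsWithin_le_nhds (s := Set.Ioi 0))
  simp only [add_zero] at tl tr
  -- Shifting every `b k` by `ε > 0` gives the definite case; then `ε → 0`.
  refine le_of_tendsto_of_tendsto tl tr ?_
  filter_upwards [self_mem_nhdsWithin] with ε hε
  exact det_conj_add_le_of_pos ha ha0 hd hd0 (fun i j hij => by linarith [hb hij])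
    (fun k => add_pos_of_nonneg_of_pos (hb0 k) hε) hU hW hA hD

/-- In the order on `ℂ`, lying below a real number forces zero imaginary part, so the inequality
also says that the determinant is real. -/
theorem theorem1 {N : ℕ} (A B : Matrix (Fin N) (Fin N) ℂ)
    (hA : A.PosSemidef) (hB : B.PosSemidef)
    (d : Fin N → ℝ) (hd_nonneg : ∀ k, 0 ≤ d k) (hd_desc : Antitone d)
    (D : Matrix (Fin N) (Fin N) ℂ) (hD : D = Matrix.diagonal (fun k => (d k : ℂ))) :
    (D.conjTranspose * A * D + B).det ≤
        ((∏ k : Fin N,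
          (d k ^ 2 * eigDesc hA.isHermitian k + eigDesc hB.isHermitian k.rev) : ℝ) : ℂ) ∧
      (A.IsDiag → B.IsDiag → Antitone A.diag → Monotone B.diag →
        A = Matrix.diagonal (fun k => (eigDesc hA.isHermitian k : ℂ)) ∧
        B = Matrix.diagonal (fun k => (eigDesc hB.isHermitian k.rev : ℂ)) ∧
        (D.conjTranspose * A * D + B).det =
          ((∏ k : Fin N,
            (d k ^ 2 * eigDesc hA.isHermitian k + eigDesc hB.isHermitian k.rev) : ℝ) : ℂ)) := by
  refine ⟨?_, fun hAd hBd hAa hBm => ?_⟩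
  · obtain ⟨U, hU, -, hUA⟩ :=
      exists_unitary_diagonalization hA.isHermitian (Equiv.refl (Fin N))
    obtain ⟨W, hW, -, hWB⟩ := exists_unitary_diagonalization hB.isHermitian Fin.revPerm
    have h := det_conj_add_le (antitone_eigDesc hA.isHermitian) (eigDesc_nonneg hA) hd_desc
      hd_nonneg (b := fun k => eigDesc hB.isHermitian k.rev)
      (fun i j hij => antitone_eigDesc hB.isHermitian (Fin.rev_le_rev.2 hij))
      (fun k => eigDesc_nonneg hB _) hU hW hUA hD
    have e : B = W * Matrix.diagonal (fun k => (eigDesc hB.isHermitian k.rev : ℂ)) *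
        W.conjTranspose := hWB
    rwa [← e] at h
  · have key : ∀ {C : Matrix (Fin N) (Fin N) ℂ}, C.IsHermitian → C.IsDiag →
        C = Matrix.diagonal (fun k => ((C k k).re : ℂ)) := by
      intro C hC hCd
      ext i j
      rcases eq_or_ne i j with rfl | hij
      · rw [Matrix.diagonal_apply_eq]
        exact (hC.coe_re_apply_self i).symm
      · rw [Matrix.diagonal_apply_ne _ hij, hCd hij]
    have roots : ∀ c : Fin N → ℂ, (Matrix.diagonal c).charpoly.roots =
        Multiset.map c Finset.univ.val := by
      intro c
      rw [Matrix.charpoly_diagonal, Polynomial.roots_prod]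
      · simp
      · simp [Finset.prod_ne_zero_iff, Polynomial.X_sub_C_ne_zero]
    have kA := key hA.isHermitian hAd
    have kB := key hB.isHermitian hBd
    have eA : eigDesc hA.isHermitian = fun k => (A k k).re := by
      refine eigDesc_eq_of_roots_charpoly _ (fun i j hij => (Complex.le_def.1 (hAa hij)).1) ?_
      conv_lhs => rw [kA]
      exact roots _
    have eB : eigDesc hB.isHermitian = fun k => (B k.rev k.rev).re := by
      refine eigDesc_eq_of_roots_charpoly _
        (fun i j hij => (Complex.le_def.1 (hBm (Fin.rev_le_rev.2 hij))).1) ?_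
      conv_lhs => rw [kB]
      rw [roots, ← Multiset.map_univ_val_equiv (Fin.revPerm (n := N)), Multiset.map_map,
        Multiset.map_univ_val_equiv]
      rfl
    have hA' : A = Matrix.diagonal (fun k => (eigDesc hA.isHermitian k : ℂ)) := by
      rw [eA]; exact kA
    have hB' : B = Matrix.diagonal (fun k => (eigDesc hB.isHermitian k.rev : ℂ)) := by
      rw [eB]; simpa only [Fin.rev_rev] using kB
    refine ⟨hA', hB', ?_⟩
    set α := eigDesc hA.isHermitian
    set β := eigDesc hB.isHermitian
    rw [hA', hB', hD, Matrix.diagonal_conjTranspose, Matrix.diagonal_mul_diagonal,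
      Matrix.diagonal_mul_diagonal, Matrix.diagonal_add, Matrix.det_diagonal]
    push_cast
    refine Finset.prod_congr rfl fun k _ => ?_
    simp only [Pi.star_apply, RCLike.star_def, Complex.conj_ofReal]
    ring
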